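/- Let $\Pi=(\mathsf{KeyGen},\mathsf{Enc},\mathsf{Dec})$ be a fixed-length classical symmetric-key encryption scheme: for the security parameter $n$ the messages are the strings in $\{0,1\}^{\ell(n)}$, where $\ell(n)$ is computable in time polynomial in $n$; $\mathsf{KeyGen}(1^n)$ and $\mathsf{Enc}_k(m)=\mathsf{Enc}_k(m;r)$ are probabilistic polynomial-time, with coins uniform in $\{0,1\}^{\rho(n)}$ for a polynomial-time computable $\rho$ (one for each algorithm), $\mathsf{Dec}_k$ is deterministic polynomial-time, and for every message $m$ one has $\mathsf{Dec}_k(\mathsf{Enc}_k(m))=m$ except with negligible probability over $k\leftarrow\mathsf{KeyGen}(1^n)$ and the coins of $\mathsf{Enc}$, uniformly in $m$. A function $\mathrm{negl}(n)$ is negligible if it is eventually smaller in absolute value than every inverse polynomial in $n$. A quantum polynomial-time (QPT) adversary $\mathcal A$ is a polynomial-time uniform family of quantum circuits of unitary gates (from a fixed universal set), computational-basis measurements and oracle gates, split into a pre-challenge circuit and a post-challenge circuit; the internal quantum state left by the first is passed to the second. An oracle gate for $\mathsf{Dec}_k$ applies $|c\rangle|y\rangle\mapsto|c\rangle|y\oplus\mathsf{Dec}_k(c)\rangle$.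 Each oracle gate for $\mathsf{Enc}_k$ samples fresh uniform coins $r$ and applies $|m\rangle|y\rangle\mapsto|m\rangle|y\oplus\mathsf{Enc}_k(m;r)\rangle$. $\mathsf{IndGame}(\Pi,\mathcal A,n)$: a key $k\leftarrow\mathsf{KeyGen}(1^n)$ and a uniformly random bit $b$ are generated. In the pre-challenge phase $\mathcal A$ has access to the oracles $\mathsf{Enc}_k$ and $\mathsf{Dec}_k$ and outputs two messages $(m_0,m_1)$. In the challenge phase $\mathcal A$ receives $\mathsf{Enc}_k(m_b)$ with fresh coins, has access to $\mathsf{Enc}_k$ only, and outputs a bit $b'$. It wins if $b=b'$. The scheme $\Pi$ is $\mathsf{IND\text{-}QCCA1}$ if for every QPT adversary $\mathcal A$ there is a negligible function $\mathrm{negl}$ such that $\Pr[\mathcal A\text{ wins }\mathsf{IndGame}(\Pi,\mathcal A,n)]\le \tfrac12+\mathrm{negl}(n)$ for all $n$. $\mathsf{IndGame}'(\Pi,\mathcal A,n)$ is the same experiment, except that in the pre-challenge phase $\mathcal A$ outputs a single message $m$, and in the challenge phase it receives $\mathsf{Enc}_k(m)$ if $b=0$, and $\mathsf{Enc}_k(x)$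 for a uniformly random message $x\in\{0,1\}^{\ell(n)}$ if $b=1$. **Proposition.** The scheme $\Pi$ is $\mathsf{IND\text{-}QCCA1}$ if and only if for every QPT adversary $\mathcal A$ there is a negligible function $\mathrm{negl}$ such that $$\Pr[\mathcal A\text{ wins }\mathsf{IndGame}'(\Pi,\mathcal A,n)]\le \tfrac12+\mathrm{negl}(n)\quad\text{for all } n.$$ -/

import Mathlib

open scoped BigOperators Matrix

namespace QCCA1

/-! ### Classical polynomial time

Programs act on finitely many stacks of bits, named by natural numbers. Every elementary operation
(a push, a pop, a test of the top of a stack) costs one step. -/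

/-- Structured programs over stacks of bits. -/
inductive Prog : Type
  | skip : Prog
  | push (r : ℕ) (b : Bool) : Prog
  | pop (r : ℕ) : Prog
  | seq (p q : Prog) : Prog
  /-- Branch on stack `r`: empty, top bit `false`, top bit `true`. -/
  | case (r : ℕ) (pEmpty pFalse pTrue : Prog) : Prog
  /-- While stack `r` is nonempty, run `p`. -/
  | loop (r : ℕ) (p : Prog) : Prog

/-- The contents of all stacks; the head of a list is the top of the stack. -/
abbrev Store : Type := ℕ → List Bool

/-- `Runs p s s' t`: started in the store `s`, the program `p` halts in the store `s'` after exactly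
`t` steps. -/
inductive Runs : Prog → Store → Store → ℕ → Prop
  | skip (s : Store) : Runs .skip s s 1
  | push (r : ℕ) (b : Bool) (s : Store) :
      Runs (.push r b) s (Function.update s r (b :: s r)) 1
  | pop (r : ℕ) (s : Store) : Runs (.pop r) s (Function.update s r (s r).tail) 1
  | seq {p q : Prog} {s s' s'' : Store} {t t' : ℕ} :
      Runs p s s' t → Runs q s' s'' t' → Runs (.seq p q) s s'' (t + t')
  | caseEmpty {r : ℕ} {pE pF pT : Prog} {s s' : Store} {t : ℕ} :
      s r = [] → Runs pE s s' t → Runs (.case r pE pF pT) s s' (t + 1)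
  | caseFalse {r : ℕ} {pE pF pT : Prog} {s s' : Store} {t : ℕ} :
      (s r).head? = some false → Runs pF s s' t → Runs (.case r pE pF pT) s s' (t + 1)
  | caseTrue {r : ℕ} {pE pF pT : Prog} {s s' : Store} {t : ℕ} :
      (s r).head? = some true → Runs pT s s' t → Runs (.case r pE pF pT) s s' (t + 1)
  | loopDone {r : ℕ} {p : Prog} {s : Store} : s r = [] → Runs (.loop r p) s s 1
  | loopStep {r : ℕ} {p : Prog} {s s' s'' : Store} {t t' : ℕ} :
      s r ≠ [] → Runs p s s' t → Runs (.loop r p) s' s'' t' → Runs (.loop r p) s s'' (t + t' + 1)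

/-- The string `1ⁿ`. -/
def unary (n : ℕ) : List Bool := List.replicate n true

/-- The initial store for a list of arguments: argument number `i` on stack `i`, all other stacks
empty. -/
def initStore (args : List (List Bool)) : Store := fun i => args.getD i []

/-- For every `n` let `args n a`, `a : ι n`, be the admissible inputs for the security parameter `n`.
One program computes `out n a` from `(1ⁿ, args n a)`, and leaves it on stack `0`, within a number of
steps that is bounded by a polynomial in `n`. -/
def PolyTime {ι : ℕ → Type} (args : (n : ℕ) → ι n → List (List Bool))
    (out : (n : ℕ) → ι n → List Bool) : Prop :=
  ∃ (p : Prog) (bound : Polynomial ℕ), ∀ (n : ℕ) (a : ι n), ∃ (s : Store) (t : ℕ),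
    Runs p (initStore (unary n :: args n a)) s t ∧ t ≤ bound.eval n ∧ s 0 = out n a

/-- The family of strings `out n` is computed from `1ⁿ` in time polynomial in `n`. -/
def Uniform (out : ℕ → List Bool) : Prop :=
  PolyTime (ι := fun _ => Unit) (fun _ _ => []) (fun n _ => out n)

/-- A negligible function: smaller in absolute value than every inverse polynomial. -/
def Negligible (ε : ℕ → ℝ) : Prop :=
  Asymptotics.SuperpolynomialDecay Filter.atTop (fun n : ℕ => (n : ℝ)) ε

/-! ### Symmetric-key encryption -/

/-- Bit strings of length `k`. -/
abbrev Bits (k : ℕ) : Type := Fin k → Bool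

/-- A fixed-length classical symmetric-key encryption scheme `(KeyGen, Enc, Dec)`. The probabilistic
algorithms `KeyGen` and `Enc` take their uniformly random coins as an explicit last argument. -/
structure EncScheme where
  keyCoinLen : ℕ → ℕ
  keyLen : ℕ → ℕ
  msgLen : ℕ → ℕ
  encCoinLen : ℕ → ℕ
  ctLen : ℕ → ℕ
  keyGen : (n : ℕ) → Bits (keyCoinLen n) → Bits (keyLen n)
  enc : (n : ℕ) → Bits (keyLen n) → Bits (msgLen n) → Bits (encCoinLen n) → Bits (ctLen n)
  dec : (n : ℕ) → Bits (keyLen n) → Bits (ctLen n) → Bits (msgLen n)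
  keyCoinLen_uniform : Uniform fun n => unary (keyCoinLen n)
  msgLen_uniform : Uniform fun n => unary (msgLen n)
  encCoinLen_uniform : Uniform fun n => unary (encCoinLen n)
  keyGen_polyTime : PolyTime (ι := fun n => Bits (keyCoinLen n))
    (fun _ s => [List.ofFn s]) (fun n s => List.ofFn (keyGen n s))
  enc_polyTime :
    PolyTime (ι := fun n => Bits (keyLen n) × Bits (msgLen n) × Bits (encCoinLen n))
      (fun _ a => [List.ofFn a.1, List.ofFn a.2.1, List.ofFn a.2.2])
      (fun n a => List.ofFn (enc n a.1 a.2.1 a.2.2))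
  dec_polyTime : PolyTime (ι := fun n => Bits (keyLen n) × Bits (ctLen n))
    (fun _ a => [List.ofFn a.1, List.ofFn a.2]) (fun n a => List.ofFn (dec n a.1 a.2))
  /-- For every message, decryption undoes encryption except with negligible probability. -/
  correct : ∃ ε : ℕ → ℝ, Negligible ε ∧ ∀ (n : ℕ) (m : Bits (msgLen n)),
    (𝔼 s : Bits (keyCoinLen n), 𝔼 r : Bits (encCoinLen n),
      if dec n (keyGen n s) (enc n (keyGen n s) m r) = m then (0 : ℝ) else 1) ≤ ε n

/-! ### Quantum circuits with oracle gates -/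

/-- Gates on `N` qubits: the universal set Pauli-X, Hadamard, `T = diag(1, exp(iπ/4))` and CNOT,
the measurement of a qubit in the computational basis, and queries to oracles that map `ℓ` bits to
`γ` bits (encryption) and `γ` bits to `ℓ` bits (decryption). For a query, the embedding
names the distinct qubits that form the input register (left) and the output register (right). -/
inductive Gate (N ℓ γ : ℕ) : Type
  | x (i : Fin N) : Gate N ℓ γ
  | h (i : Fin N) : Gate N ℓ γ
  | t (i : Fin N) : Gate N ℓ γ
  | cnot (i j : Fin N) (hij : i ≠ j) : Gate N ℓ γ
  | measure (i : Fin N) : Gate N ℓ γ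
  | enc (q : Fin ℓ ⊕ Fin γ ↪ Fin N) : Gate N ℓ γ
  | dec (q : Fin γ ⊕ Fin ℓ ↪ Fin N) : Gate N ℓ γ

/-- The gate is not a query to the decryption oracle. -/
def Gate.NoDec {N ℓ γ : ℕ} : Gate N ℓ γ → Prop
  | .dec _ => False
  | _ => True

/-- The code of a wire: its index in unary, then the end marker `0`. -/
def wireCode {N : ℕ} (i : Fin N) : List Bool := unary i ++ [false]

/-- The code of a sequence of wires. -/
def wiresCode {N a : ℕ} (w : Fin a → Fin N) : List Bool :=
  (List.ofFn fun i => wireCode (w i)).flatten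

/-- The code of a gate: three bits for its kind, then the wires that it acts on. -/
def Gate.code {N ℓ γ : ℕ} : Gate N ℓ γ → List Bool
  | .x i => [false, false, false] ++ wireCode i
  | .h i => [false, false, true] ++ wireCode i
  | .t i => [false, true, false] ++ wireCode i
  | .cnot i j _ => [false, true, true] ++ wireCode i ++ wireCode j
  | .measure i => [true, false, false] ++ wireCode i
  | .enc q => [true, false, true] ++ wiresCode (fun i => q (.inl i)) ++
      wiresCode (fun i => q (.inr i))
  | .dec q => [true, true, false] ++ wiresCode (fun i => q (.inl i)) ++
      wiresCode (fun i => q (.inr i))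

/-- The code of a circuit: the codes of its gates in the order of execution. -/
def circuitCode {N ℓ γ : ℕ} (C : List (Gate N ℓ γ)) : List Bool := (C.map Gate.code).flatten

/-- (Possibly subnormalised) density matrices of `N` qubits, in the computational basis. -/
abbrev QState (N : ℕ) : Type := Matrix (Bits N) (Bits N) ℂ

/-- The pure state `|0…0⟩⟨0…0|`. -/
def zeroState (N : ℕ) : QState N := Matrix.single (fun _ => false) (fun _ => false) 1

/-- The action `ρ ↦ U ρ U*` of an operator on a state. -/
def conj {N : ℕ} (U : Matrix (Bits N) (Bits N) ℂ) (ρ : QState N) : QState N := U * ρ * Uᴴ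

/-- The one-qubit operator `u` applied to qubit `i`. -/
def onQubit {N : ℕ} (i : Fin N) (u : Matrix Bool Bool ℂ) : Matrix (Bits N) (Bits N) ℂ :=
  Matrix.of fun x y => if ∀ j, j ≠ i → x j = y j then u (x i) (y i) else 0

/-- The operator `|x⟩ ↦ |f x⟩`. -/
def basisMap {N : ℕ} (f : Bits N → Bits N) : Matrix (Bits N) (Bits N) ℂ :=
  Matrix.of fun x y => if x = f y then 1 else 0

/-- `(1/√2) [[1, 1], [1, -1]]`. -/
noncomputable def hadamard : Matrix Bool Bool ℂ :=
  Matrix.of fun a b => (if a && b then -1 else 1) / (Real.sqrt 2 : ℂ)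

/-- `diag(1, exp(iπ/4))`. -/
noncomputable def tGate : Matrix Bool Bool ℂ :=
  Matrix.diagonal fun a => if a then Complex.exp (Complex.I * Real.pi / 4) else 1

/-- Add the string `v`, bitwise modulo 2, to the qubits `w 0, w 1, …` of a basis state. -/
def xorAt {N b : ℕ} (w : Fin b ↪ Fin N) (v : Bits b) (x : Bits N) : Bits N :=
  fun i => xor (x i) (decide (∃ j, w j = i ∧ v j = true))

/-- The oracle unitary `|x⟩|y⟩ ↦ |x⟩|y ⊕ f(x)⟩` on the qubits named by `q`. -/
def oracleU {N a b : ℕ} (q : Fin a ⊕ Fin b ↪ Fin N) (f : Bits a → Bits b) :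
    Matrix (Bits N) (Bits N) ℂ :=
  basisMap fun x => xorAt (Function.Embedding.inr.trans q) (f fun i => x (q (.inl i))) x

/-- The part of a state for which measuring the qubits `w a`, `a : α`, gives `v`. Its trace is the
probability of the outcome `v`. -/
def project {N : ℕ} {α : Type} [Fintype α] (w : α ↪ Fin N) (v : α → Bool) (ρ : QState N) :
    QState N :=
  Matrix.of fun x y => if (∀ a, x (w a) = v a) ∧ (∀ a, y (w a) = v a) then ρ x y else 0

/-- The action of a gate on a state, for the key `k`. Each query to the encryption oracle uses fresh
uniformly random coins. -/
noncomputable def Gate.apply (S : EncScheme) {n N : ℕ} (k : Bits (S.keyLen n)) :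
    Gate N (S.msgLen n) (S.ctLen n) → QState N → QState N
  | .x i, ρ => conj (basisMap fun z => Function.update z i (!(z i))) ρ
  | .h i, ρ => conj (onQubit i hadamard) ρ
  | .t i, ρ => conj (onQubit i tGate) ρ
  | .cnot i j _, ρ => conj (basisMap fun z => Function.update z j (xor (z j) (z i))) ρ
  | .measure i, ρ => Matrix.of fun x y => if x i = y i then ρ x y else 0
  | .enc q, ρ => 𝔼 r : Bits (S.encCoinLen n), conj (oracleU q fun m => S.enc n k m r) ρ
  | .dec q, ρ => conj (oracleU q fun c => S.dec n k c) ρ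

/-- The state after executing the gates of a circuit in order. -/
noncomputable def runCircuit (S : EncScheme) {n N : ℕ} (k : Bits (S.keyLen n))
    (C : List (Gate N (S.msgLen n) (S.ctLen n))) (ρ : QState N) : QState N :=
  C.foldl (fun σ g => g.apply S k σ) ρ

/-! ### Adversaries and games -/

/-- A quantum polynomial-time adversary that outputs `j` challenge messages: two uniform families of
quantum circuits, which share their qubits. All qubits start in `|0⟩`. The circuit `pre n` has
access to both oracles; then the qubits `out n (i, ·)` are measured and give the challenge message
number `i`. The challenge ciphertext is added modulo 2 to the qubits `chal n`, so it arrives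
unchanged when the adversary has left these in the state `|0⟩`. The circuit `post n` has access to
the encryption oracle only, and finally the qubit `answer n` is measured and gives the output bit. -/
structure Adversary (S : EncScheme) (j : ℕ) where
  width : ℕ → ℕ
  pre : (n : ℕ) → List (Gate (width n) (S.msgLen n) (S.ctLen n))
  out : (n : ℕ) → Fin j × Fin (S.msgLen n) ↪ Fin (width n)
  chal : (n : ℕ) → Fin (S.ctLen n) ↪ Fin (width n)
  post : (n : ℕ) → List (Gate (width n) (S.msgLen n) (S.ctLen n))
  answer : (n : ℕ) → Fin (width n)
  post_noDec : ∀ n, ∀ g ∈ post n, g.NoDec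
  width_uniform : Uniform fun n => unary (width n)
  pre_uniform : Uniform fun n => circuitCode (pre n)
  out_uniform : ∀ i : Fin j, Uniform fun n => wiresCode fun a => out n (i, a)
  chal_uniform : Uniform fun n => wiresCode (chal n)
  post_uniform : Uniform fun n => circuitCode (post n)
  answer_uniform : Uniform fun n => wireCode (answer n)

/-- The probability, for the key `k`, that the adversary outputs the challenge messages `m` and
then, on the challenge ciphertext `c`, the bit `b`. -/
noncomputable def Adversary.prob {S : EncScheme} {j : ℕ} (A : Adversary S j) (n : ℕ)
    (k : Bits (S.keyLen n)) (m : Fin j → Bits (S.msgLen n)) (c : Bits (S.ctLen n)) (b : Bool) : ℝ :=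
  let ρ₁ := runCircuit S k (A.pre n) (zeroState (A.width n))
  let ρ₂ := project (A.out n) (fun a => m a.1 a.2) ρ₁
  let ρ₃ := conj (basisMap (xorAt (A.chal n) c)) ρ₂
  let ρ₄ := runCircuit S k (A.post n) ρ₃
  ∑ z : Bits (A.width n), if z (A.answer n) = b then (ρ₄ z z).re else 0

/-- `Pr[A wins IndGame(Π, A, n)]`: the adversary outputs `(m₀, m₁)` and receives `Enc_k(m_b)`. -/
noncomputable def indGameWinProb (S : EncScheme) (A : Adversary S 2) (n : ℕ) : ℝ :=
  𝔼 s : Bits (S.keyCoinLen n), 𝔼 b : Bool, ∑ m : Fin 2 → Bits (S.msgLen n),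
    𝔼 r : Bits (S.encCoinLen n),
      A.prob n (S.keyGen n s) m (S.enc n (S.keyGen n s) (if b then m 1 else m 0) r) b

/-- `Pr[A wins IndGame'(Π, A, n)]`: the adversary outputs one message `m` and receives `Enc_k(m)` if
`b = 0`, and `Enc_k(x)` for a uniformly random message `x` if `b = 1`. -/
noncomputable def indGame'WinProb (S : EncScheme) (A : Adversary S 1) (n : ℕ) : ℝ :=
  𝔼 s : Bits (S.keyCoinLen n), 𝔼 b : Bool, ∑ m : Fin 1 → Bits (S.msgLen n),
    𝔼 x : Bits (S.msgLen n), 𝔼 r : Bits (S.encCoinLen n),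
      A.prob n (S.keyGen n s) m (S.enc n (S.keyGen n s) (if b then x else m 0) r) b

/-- Indistinguishable encryptions under non-adaptive quantum chosen ciphertext attack. -/
def IsINDQCCA1 (S : EncScheme) : Prop :=
  ∀ A : Adversary S 2, ∃ ε : ℕ → ℝ, Negligible ε ∧ ∀ n, indGameWinProb S A n ≤ 1 / 2 + ε n

end QCCA1

namespace QCCA1

/-! ### Programs -/

/-! Both directions are reductions with exact formulas for the winning probabilities; no asymptotics
enters before the last lines. An adversary $A$ against $\mathsf{IndGame}'$ becomes one against
$\mathsf{IndGame}$ by submitting, next to its own message, a uniform string read from fresh qubits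
in the state $|+\rangle$. The fresh qubits are independent of everything else, so the winning
probability is the same (`Adversary.addRandom_winProb`). Conversely, let $A$ submit $(m_0,m_1)$. The
adversary `A.pick d` submits $m_d$ alone, measures the other message and adds $d$ to the answer.
Write $p_i(c)$ for the probability that $A$ answers $i$ on a challenge ciphertext of kind $c$, and
let $x$ be uniform. The two reductions win with probabilities $\frac12(p_0(m_0)+p_1(x))$ and
$\frac12(p_1(m_1)+p_0(x))$. Since $p_0(x)+p_1(x)=1$, these add up to the winning probability of $A$
plus $\frac12$ (`Adversary.pick_winProb_add`). The relation $p_0+p_1=1$ is trace preservation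
(`Adversary.sum_prob`). The reductions must also be uniform circuit families. Their codes arise from
those of $A$ by concatenation, by runs of consecutive wires and by putting a gate's kind before each
wire: `Uniform.append`, `Uniform.wires` and `Uniform.prefixWires`, all instances of `Uniform.post`.
-/

theorem unary_add (a b : ℕ) : unary (a + b) = unary a ++ unary b := List.replicate_add ..

/-- Rename the stacks of a program. -/
def Prog.rename (e : ℕ → ℕ) : Prog → Prog
  | .skip => .skip
  | .push r b => .push (e r) b
  | .pop r => .pop (e r)
  | .seq p q => .seq (p.rename e) (q.rename e)
  | .case r pE pF pT => .case (e r) (pE.rename e) (pF.rename e) (pT.rename e)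
  | .loop r p => .loop (e r) (p.rename e)

/-- A renamed program does the same on the renamed stacks and leaves the others alone. -/
theorem Runs.rename {e : ℕ → ℕ} (he : Function.Injective e) {p : Prog} {s s' : Store} {t : ℕ}
    (h : Runs p s s' t) : ∀ σ : Store, (∀ i, σ (e i) = s i) →
      ∃ σ', Runs (p.rename e) σ σ' t ∧ (∀ i, σ' (e i) = s' i) ∧
        ∀ j, j ∉ Set.range e → σ' j = σ j := by
  induction h with
  | skip s => exact fun σ hσ => ⟨σ, .skip σ, hσ, fun _ _ => rfl⟩
  | push r b s =>
    intro σ hσ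
    refine ⟨_, .push (e r) b σ, fun i => ?_, fun j hj => ?_⟩
    · simp [Function.update_apply, he.eq_iff, hσ]
    · rw [Function.update_of_ne]
      rintro rfl
      exact hj ⟨r, rfl⟩
  | pop r s =>
    intro σ hσ
    refine ⟨_, .pop (e r) σ, fun i => ?_, fun j hj => ?_⟩
    · simp [Function.update_apply, he.eq_iff, hσ]
    · rw [Function.update_of_ne]
      rintro rfl
      exact hj ⟨r, rfl⟩
  | seq _ _ ih₁ ih₂ =>
    intro σ hσ
    obtain ⟨σ₁, h₁, a₁, b₁⟩ := ih₁ σ hσ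
    obtain ⟨σ₂, h₂, a₂, b₂⟩ := ih₂ σ₁ a₁
    exact ⟨σ₂, .seq h₁ h₂, a₂, fun j hj => (b₂ j hj).trans (b₁ j hj)⟩
  | caseEmpty hr _ ih =>
    intro σ hσ
    obtain ⟨σ₁, h₁, a₁, b₁⟩ := ih σ hσ
    exact ⟨σ₁, .caseEmpty (by rw [hσ, hr]) h₁, a₁, b₁⟩
  | caseFalse hr _ ih =>
    intro σ hσ
    obtain ⟨σ₁, h₁, a₁, b₁⟩ := ih σ hσ
    exact ⟨σ₁, .caseFalse (by rw [hσ, hr]) h₁, a₁, b₁⟩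
  | caseTrue hr _ ih =>
    intro σ hσ
    obtain ⟨σ₁, h₁, a₁, b₁⟩ := ih σ hσ
    exact ⟨σ₁, .caseTrue (by rw [hσ, hr]) h₁, a₁, b₁⟩
  | loopDone hr => exact fun σ hσ => ⟨σ, .loopDone (by rw [hσ, hr]), hσ, fun _ _ => rfl⟩
  | loopStep hr _ _ ih₁ ih₂ =>
    intro σ hσ
    obtain ⟨σ₁, h₁, a₁, b₁⟩ := ih₁ σ hσ
    obtain ⟨σ₂, h₂, a₂, b₂⟩ := ih₂ σ₁ a₁
    exact ⟨σ₂, .loopStep (by rwa [hσ]) h₁ h₂, a₂, fun j hj => (b₂ j hj).trans (b₁ j hj)⟩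

/-- A stack grows by at most one bit in every step. -/
theorem Runs.length_le {p : Prog} {s s' : Store} {t : ℕ} (h : Runs p s s' t) :
    ∀ i, (s' i).length ≤ (s i).length + t := by
  induction h with
  | skip s => simp
  | push r b s =>
    intro i
    rcases eq_or_ne i r with rfl | hi <;> simp [*]
  | pop r s =>
    intro i
    rcases eq_or_ne i r with rfl | hi
    · simp only [Function.update_self, List.length_tail]; omega
    · simp [*]
  | seq _ _ ih₁ ih₂ => intro i; have := ih₁ i; have := ih₂ i; omega
  | caseEmpty _ _ ih => intro i; have := ih i; omega
  | caseFalse _ _ ih => intro i; have := ih i; omega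
  | caseTrue _ _ ih => intro i; have := ih i; omega
  | loopDone _ => simp
  | loopStep _ _ _ ih₁ ih₂ => intro i; have := ih₁ i; have := ih₂ i; omega

/-- Started in `s`, the program halts in `s'` after at most `T` steps. -/
def Does (p : Prog) (s s' : Store) (T : ℕ) : Prop := ∃ t ≤ T, Runs p s s' t

theorem Does.mono {p : Prog} {s s' : Store} {T T' : ℕ} (h : Does p s s' T) (hT : T ≤ T') :
    Does p s s' T' :=
  let ⟨t, ht, hr⟩ := h
  ⟨t, ht.trans hT, hr⟩

theorem Does.of_eq {p : Prog} {s s' s'' : Store} {T : ℕ} (h : Does p s s' T) (hs : s' = s'') :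
    Does p s s'' T := hs ▸ h

theorem Does.seq {p q : Prog} {s s' s'' : Store} {T T' : ℕ} (h : Does p s s' T)
    (h' : Does q s' s'' T') : Does (.seq p q) s s'' (T + T') :=
  let ⟨t, ht, hr⟩ := h
  let ⟨t', ht', hr'⟩ := h'
  ⟨t + t', Nat.add_le_add ht ht', hr.seq hr'⟩

theorem Does.push (r : ℕ) (b : Bool) (s : Store) :
    Does (.push r b) s (Function.update s r (b :: s r)) 1 := ⟨1, le_rfl, .push r b s⟩

theorem Does.pop (r : ℕ) (s : Store) :
    Does (.pop r) s (Function.update s r (s r).tail) 1 := ⟨1, le_rfl, .pop r s⟩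

theorem Does.loop_done {r : ℕ} {p : Prog} {s : Store} (h : s r = []) :
    Does (.loop r p) s s 1 := ⟨1, le_rfl, .loopDone h⟩

theorem Does.loop_step {r : ℕ} {p : Prog} {s s' s'' : Store} {T T' : ℕ} (h : s r ≠ [])
    (h₁ : Does p s s' T) (h₂ : Does (.loop r p) s' s'' T') :
    Does (.loop r p) s s'' (T + T' + 1) :=
  let ⟨t, ht, hr⟩ := h₁
  let ⟨t', ht', hr'⟩ := h₂
  ⟨t + t' + 1, by omega, .loopStep h hr hr'⟩

/-- Branching on a nonempty stack. -/
theorem Does.case_cons {r : ℕ} {pE pF pT : Prog} {s s' : Store} {T : ℕ} {b : Bool} {l : List Bool}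
    (h : s r = b :: l) (hp : Does (if b then pT else pF) s s' T) :
    Does (.case r pE pF pT) s s' (T + 1) := by
  obtain ⟨t, ht, hr⟩ := hp
  refine ⟨t + 1, by omega, ?_⟩
  cases b
  · exact .caseFalse (by simp [h]) hr
  · exact .caseTrue (by simp [h]) hr

/-! ### Subroutines on stacks -/

/-- Push a string on a stack. -/
def pushList (r : ℕ) : List Bool → Prog
  | [] => .skip
  | b :: w => .seq (pushList r w) (.push r b)

theorem does_pushList (r : ℕ) (w : List Bool) (s : Store) :
    Does (pushList r w) s (Function.update s r (w ++ s r)) (w.length + 1) := by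
  induction w with
  | nil => exact ⟨1, by simp, by simpa [pushList] using Runs.skip s⟩
  | cons b w ih =>
    refine ((ih.seq (.push r b _)).of_eq ?_).mono (by simp)
    simp

/-- Remove `k` bits from a stack. -/
def popMany (r : ℕ) : ℕ → Prog
  | 0 => .skip
  | k + 1 => .seq (.pop r) (popMany r k)

theorem does_popMany (r k : ℕ) (s : Store) :
    Does (popMany r k) s (Function.update s r ((s r).drop k)) (k + 1) := by
  induction k generalizing s with
  | zero => exact ⟨1, by simp, by simpa [popMany] using Runs.skip s⟩
  | succ k ih =>
    refine (((Does.pop r s).seq (ih _)).of_eq ?_).mono (by omega)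
    cases s r <;> simp

/-- Move the contents of a stack to another one, in reverse order. -/
def move (a b : ℕ) : Prog :=
  .loop a (.case a .skip (.seq (.pop a) (.push b false)) (.seq (.pop a) (.push b true)))

/-- Each bit costs four steps: the loop test, the branch, a pop and a push. -/
theorem does_move {a b : ℕ} (hab : a ≠ b) {l : List Bool} {s : Store} (hs : s a = l) :
    Does (move a b) s (Function.update (Function.update s a []) b (l.reverse ++ s b))
      (4 * l.length + 1) := by
  induction l generalizing s with
  | nil =>
    refine (Does.loop_done hs).of_eq ?_
    funext i
    by_cases hb : i = b <;> by_cases ha : i = a <;> simp_all [Function.update_apply]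
  | cons x l ih =>
    have hx : Does (if x then .seq (.pop a) (.push b true) else .seq (.pop a) (.push b false)) s
        (Function.update (Function.update s a l) b (x :: s b)) 2 := by
      cases x <;>
      · refine ((Does.pop a s).seq (.push b _ _)).of_eq ?_
        simp [hs, hab.symm]
    refine ((Does.loop_step (by simp [hs]) (Does.case_cons hs hx)
      (ih (s := Function.update (Function.update s a l) b (x :: s b)) ?_)).of_eq ?_).mono ?_
    · simp [hab]
    · funext i
      by_cases hb : i = b <;> by_cases ha : i = a <;> simp [*]
    · simp only [List.length_cons]; omega

/-- Move a unary number to two other stacks. -/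
def dup (a b c : ℕ) : Prog :=
  .loop a (.seq (.pop a) (.seq (.push b true) (.push c true)))

theorem does_dup {a b c : ℕ} (hab : a ≠ b) (hac : a ≠ c) (hbc : b ≠ c) {k : ℕ} {s : Store}
    (hs : s a = unary k) :
    Does (dup a b c) s (Function.update (Function.update (Function.update s a []) b
      (unary k ++ s b)) c (unary k ++ s c)) (4 * k + 1) := by
  induction k generalizing s with
  | zero =>
    refine (Does.loop_done hs).of_eq ?_
    have : s a = [] := hs
    rw [← this]; simp [unary]
  | succ k ih =>
    refine ((Does.loop_step (by simp [hs, unary]) ((Does.pop a s).seq ((Does.push b true _).seq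
      (.push c true _))) (ih ?_)).of_eq ?_).mono ?_
    · simp [hab, hac, hs, unary]
    · have h1 : ∀ k l, unary k ++ true :: l = true :: (unary k ++ l) := by
        intro k l
        simp only [unary]
        rw [← List.cons_append, ← List.replicate_succ, List.replicate_succ', List.append_assoc]
        rfl
      have h2 : unary (k + 1) = true :: unary k := rfl
      funext i
      by_cases hb : i = b <;> by_cases ha : i = a <;> by_cases hc : i = c <;>
        simp_all [Function.update_apply]
    · omega

/-- Put a copy of the unary number on stack `a` on top of stack `b`, with the help of stack `c`. -/
def prepend (a b c : ℕ) : Prog := .seq (dup a b c) (move c a)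

/-- `dup` empties `a` into `b` and `c`, and moving `c` back restores `a`. The reversal by `move` is
harmless on a unary string. -/
theorem does_prepend {a b c : ℕ} (hab : a ≠ b) (hac : a ≠ c) (hbc : b ≠ c) {k : ℕ} {s : Store}
    (hs : s a = unary k) (hc : s c = []) :
    Does (prepend a b c) s (Function.update s b (unary k ++ s b)) (8 * k + 2) := by
  refine (((does_dup hab hac hbc hs).seq (does_move (l := unary k) hac.symm ?_)).of_eq ?_).mono ?_
  · simp [hc]
  · funext i
    by_cases hib : i = b <;> by_cases hia : i = a <;> by_cases hic : i = c <;>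
      simp_all [Function.update_apply, unary]
  · simp [unary]; omega

/-! ### Closure properties of uniform families -/

theorem eval_mono (P : Polynomial ℕ) {a b : ℕ} (h : a ≤ b) : P.eval a ≤ P.eval b := by
  simp only [Polynomial.eval_eq_sum, Polynomial.sum]
  gcongr

/-- Strings computed from two uniform families by a polynomial-time program, which finds its inputs
on the stacks `1` and `2` and may use the stacks `3 * i`, are uniform. -/
theorem Uniform.post {f g h : ℕ → List Bool} (hf : Uniform f) (hg : Uniform g) (Q : Prog)
    (B : Polynomial ℕ)
    (hQ : ∀ (n : ℕ) (s : Store), s 1 = f n → s 2 = g n → (∀ i, s (3 * i) = []) →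
      ∃ s', Does Q s s' (B.eval ((f n).length + (g n).length)) ∧ s' 0 = h n) : Uniform h := by
  obtain ⟨p, bp, hp⟩ := hf
  obtain ⟨q, bq, hq⟩ := hg
  -- The stacks are split by residue modulo 3: the two given programs run on the classes 1 and 2,
  -- where stacks 1 and 2 play the role of their stack 0, and class 0 stays empty for `Q`.
  refine ⟨.seq (dup 0 1 2) (.seq (p.rename fun i => 3 * i + 1)
      (.seq (q.rename fun i => 3 * i + 2) Q)),
    4 * Polynomial.X + 1 + (bp + (bq + B.comp (2 * Polynomial.X + bp + bq))), fun n _ => ?_⟩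
  obtain ⟨sp, tp, rp, lp, op⟩ := hp n ()
  obtain ⟨sq, tq, rq, lq, oq⟩ := hq n ()
  have e₁ : Function.Injective fun i : ℕ => 3 * i + 1 := fun i j => by simp
  have e₂ : Function.Injective fun i : ℕ => 3 * i + 2 := fun i j => by simp
  have h0 : ∀ i, initStore [unary n] (i + 1) = [] := by simp [initStore]
  have h00 : initStore [unary n] 0 = unary n := by simp [initStore]
  obtain ⟨t₀, l₀, r₀⟩ := does_dup (a := 0) (b := 1) (c := 2) (by simp) (by simp) (by simp)
    (s := initStore [unary n]) h00
  set σ₀ := Function.update (Function.update (Function.update (initStore [unary n]) 0 []) 1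
      (unary n ++ initStore [unary n] 1)) 2 (unary n ++ initStore [unary n] 2) with hσ₀
  obtain ⟨σ₁, r₁, a₁, b₁⟩ := rp.rename e₁ σ₀ (by
    rintro (_ | i)
    · simp [hσ₀, initStore]
    · rw [h0, hσ₀, Function.update_of_ne (by omega), Function.update_of_ne (by omega),
        Function.update_of_ne (by omega), h0])
  obtain ⟨σ₂, r₂, a₂, b₂⟩ := rq.rename e₂ σ₁ (by
    intro i
    rw [b₁ _ (by rintro ⟨j, hj⟩; dsimp only at hj; omega)]
    rcases i with _ | i
    · simp [hσ₀, initStore]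
    · rw [h0, hσ₀, Function.update_of_ne (by omega), Function.update_of_ne (by omega),
        Function.update_of_ne (by omega), h0])
  obtain ⟨s', ⟨t₃, l₃, r₃⟩, o₃⟩ := hQ n σ₂
    (by rw [b₂ _ (by rintro ⟨j, hj⟩; dsimp only at hj; omega)]; simpa [op] using a₁ 0)
    (by simpa [oq] using a₂ 0)
    (fun i => by
      rw [b₂ _ (by rintro ⟨j, hj⟩; dsimp only at hj; omega),
        b₁ _ (by rintro ⟨j, hj⟩; dsimp only at hj; omega), hσ₀, Function.update_of_ne (by omega),
        Function.update_of_ne (by omega)]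
      rcases i with _ | i
      · simp
      · rw [Function.update_of_ne (by omega)]; exact h0 (3 * i + 2))
  refine ⟨s', _, .seq r₀ (.seq r₁ (.seq r₂ r₃)), ?_, o₃⟩
  -- An output is no longer than the input plus the running time, so the inputs of `Q` have
  -- polynomial length and its time bound is polynomial in `n`.
  have k₁ : (f n).length ≤ n + bp.eval n := by
    have := rp.length_le 0
    rw [op, h00] at this
    simp only [unary, List.length_replicate] at this
    omega
  have k₂ : (g n).length ≤ n + bq.eval n := by
    have := rq.length_le 0
    rw [oq, h00] at this
    simp only [unary, List.length_replicate] at this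
    omega
  have k₃ := eval_mono B (show (f n).length + (g n).length ≤ 2 * n + bp.eval n + bq.eval n by omega)
  simp only [Polynomial.eval_add, Polynomial.eval_mul, Polynomial.eval_comp, Polynomial.eval_X,
    Polynomial.eval_ofNat, Polynomial.eval_one]
  omega

theorem uniform_const (w : List Bool) : Uniform fun _ => w := by
  -- The input `1ⁿ` sits on the output stack and has to be erased first.
  refine ⟨.seq (.loop 0 (.pop 0)) (pushList 0 w), 2 * Polynomial.X + 2 + (w.length : Polynomial ℕ),
    fun n _ => ?_⟩
  have h : ∀ (k : ℕ) (s : Store), s 0 = unary k →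
      Does (.loop 0 (.pop 0)) s (Function.update s 0 []) (2 * k + 1) := by
    intro k
    induction k with
    | zero =>
      intro s hs
      refine (Does.loop_done hs).of_eq ?_
      have : s 0 = [] := hs
      rw [← this]; simp
    | succ k ih =>
      intro s hs
      refine ((Does.loop_step (by simp [hs, unary]) (Does.pop 0 s) (ih _ ?_)).of_eq ?_).mono ?_
      · simp [hs, unary]
      · simp
      · omega
  obtain ⟨t, ht, hr⟩ := (h n (initStore [unary n]) (by simp [initStore])).seq (does_pushList 0 w _)
  refine ⟨_, t, hr, ?_, by simp⟩
  simp only [Polynomial.eval_add, Polynomial.eval_mul, Polynomial.eval_X,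
    Polynomial.eval_ofNat, Polynomial.eval_natCast]
  simp only [Nat.cast_id]
  omega

theorem Uniform.append {f g : ℕ → List Bool} (hf : Uniform f) (hg : Uniform g) :
    Uniform fun n => f n ++ g n := by
  -- Every string passes through stack 3, so that two reversals cancel; `g n` goes first because the
  -- later string ends up on top.
  refine hf.post hg (.seq (move 2 3) (.seq (move 3 0) (.seq (move 1 3) (move 3 0))))
    (8 * Polynomial.X + 4) fun n s h₁ h₂ h₃ => ?_
  have h0 := h₃ 0
  have h3 := h₃ 1
  simp only [Nat.mul_zero, Nat.mul_one] at h0 h3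
  refine ⟨_, ((does_move (l := g n) (by decide) ?_).seq ((does_move (l := (g n).reverse) (by decide)
    ?_).seq ((does_move (l := f n) (by decide) ?_).seq
    (does_move (l := (f n).reverse) (by decide) ?_)))).mono ?_, ?_⟩
  · exact h₂
  · simp [h3]
  · simp [h₁]
  · simp
  · simp; omega
  · simp [h0]

/-- The codes of consecutive wires, the first of them with index `W`, each after the string `w`, are
uniform. -/
theorem Uniform.wires {W l : ℕ → ℕ} (hW : Uniform fun n => unary (W n))
    (hl : Uniform fun n => unary (l n)) (w : List Bool) :
    Uniform fun n => (List.range (l n)).flatMap fun a => w ++ (unary (W n + a) ++ [false]) := by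
  -- Stack 2 counts down from `l`, so the last wire is written first and the first one ends on top.
  -- Within a wire the code is likewise pushed from its end marker backwards.
  refine hW.post hl (.loop 2 (.seq (.pop 2) (.seq (.push 0 false) (.seq (prepend 2 0 3)
    (.seq (prepend 1 0 3) (pushList 0 w))))))
    (((16 + w.length : ℕ) : Polynomial ℕ) * (Polynomial.X + 1) ^ 2) fun n s h₁ h₂ h₃ => ?_
  have key : ∀ (W l : ℕ) (s : Store), s 1 = unary W → s 2 = unary l → s 3 = [] → ∃ s',
      Does (.loop 2 (.seq (.pop 2) (.seq (.push 0 false) (.seq (prepend 2 0 3)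
        (.seq (prepend 1 0 3) (pushList 0 w)))))) s s' (l * (8 * l + 8 * W + w.length + 8) + 1) ∧
      s' 0 = ((List.range l).flatMap fun a => w ++ (unary (W + a) ++ [false])) ++ s 0 := by
    intro W l
    induction l with
    | zero => exact fun s _ h _ => ⟨s, (Does.loop_done h).mono (by omega), by simp⟩
    | succ l ih =>
      intro s h₁ h₂ h₃
      obtain ⟨s₁, hb, e₀, e₁, e₂, e₃⟩ : ∃ s₁, Does (.seq (.pop 2) (.seq (.push 0 false)
          (.seq (prepend 2 0 3) (.seq (prepend 1 0 3) (pushList 0 w))))) s s₁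
          (8 * l + 8 * W + w.length + 7) ∧
          s₁ 0 = w ++ (unary W ++ (unary l ++ false :: s 0)) ∧ s₁ 1 = unary W ∧
          s₁ 2 = unary l ∧ s₁ 3 = [] :=
        ⟨_, ((Does.pop 2 s).seq ((Does.push 0 false _).seq
          ((does_prepend (a := 2) (b := 0) (c := 3) (k := l) (by decide) (by decide) (by decide)
            (by simp [h₂, unary]) (by simp [h₃])).seq
          ((does_prepend (a := 1) (b := 0) (c := 3) (k := W) (by decide) (by decide) (by decide)
            (by simp [h₁]) (by simp [h₃])).seq (does_pushList 0 w _))))).mono (by omega),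
          by simp, by simp [h₁], by simp [h₂, unary], by simp [h₃]⟩
      obtain ⟨s', hs', e⟩ := ih s₁ e₁ e₂ e₃
      refine ⟨s', (Does.loop_step (by simp [h₂, unary]) hb hs').mono (by nlinarith), ?_⟩
      rw [e, e₀]
      simp [List.range_succ, unary_add]
  obtain ⟨s', hs', e⟩ := key (W n) (l n) s h₁ h₂ (by simpa using h₃ 1)
  refine ⟨s', hs'.mono ?_, ?_⟩
  · simp only [unary, List.length_replicate, Polynomial.eval_mul, Polynomial.eval_natCast,
      Polynomial.eval_pow, Polynomial.eval_add, Polynomial.eval_X, Polynomial.eval_one, Nat.cast_id]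
    nlinarith [Nat.zero_le (W n), Nat.zero_le (l n), Nat.zero_le w.length,
      Nat.zero_le (W n * l n), Nat.zero_le (w.length * l n), Nat.zero_le (w.length * W n),
      Nat.zero_le (w.length * (W n + l n)^2)]
  · rw [e, show s 0 = [] by simpa using h₃ 0, List.append_nil]

/-- The concatenation of the codes of wires, each after the string `w`, is uniform if the codes of
the wires are. -/
theorem Uniform.prefixWires {l N : ℕ → ℕ} {v : (n : ℕ) → Fin (l n) → Fin (N n)}
    (hv : Uniform fun n => wiresCode (v n)) (w : List Bool) :
    Uniform fun n => (List.ofFn fun a => w ++ wireCode (v n a)).flatten := by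
  -- Write `w` once, then copy the code and insert `w` after every end marker. One `w` too many
  -- remains at the end; stack 3 holds the text reversed, so the surplus is on top and `popMany`
  -- removes it.
  refine hv.post hv (.seq (pushList 3 w.reverse) (.seq (.loop 1 (.case 1 .skip
      (.seq (.pop 1) (.seq (.push 3 false) (pushList 3 w.reverse)))
      (.seq (.pop 1) (.push 3 true)))) (.seq (popMany 3 w.length) (move 3 0))))
    (Polynomial.X * ((20 + 20 * w.length : ℕ) : Polynomial ℕ) +
    ((20 + 20 * w.length : ℕ) : Polynomial ℕ)) fun n s h₁ _ h₃ => ?_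
  let ins : List Bool → List Bool := fun c => c.flatMap fun b => if b then [true] else false :: w
  have key : ∀ (c : List Bool) (s : Store), s 1 = c → ∃ s',
      Does (.loop 1 (.case 1 .skip
        (.seq (.pop 1) (.seq (.push 3 false) (pushList 3 w.reverse)))
        (.seq (.pop 1) (.push 3 true)))) s s' (c.length * (w.length + 6) + 1) ∧
      s' 3 = (ins c).reverse ++ s 3 ∧ s' 0 = s 0 := by
    intro c
    induction c with
    | nil => exact fun s h => ⟨s, (Does.loop_done h).mono (by omega), by simp [ins], rfl⟩
    | cons b c ih =>
      intro s h
      obtain ⟨s₁, d₁, e₁, e₃, e₀⟩ : ∃ s₁, Does (if b then .seq (.pop 1) (.push 3 true) else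
          .seq (.pop 1) (.seq (.push 3 false) (pushList 3 w.reverse))) s s₁ (w.length + 3) ∧
          s₁ 1 = c ∧ s₁ 3 = (if b then [true] else false :: w).reverse ++ s 3 ∧ s₁ 0 = s 0 := by
        cases b
        · exact ⟨_, ((Does.pop 1 s).seq ((Does.push 3 false _).seq (does_pushList 3 w.reverse _))).mono
            (by simp; omega), by simp [h], by simp, by simp⟩
        · exact ⟨_, ((Does.pop 1 s).seq (Does.push 3 true _)).mono (by omega), by simp [h], by simp,
            by simp⟩
      obtain ⟨s', d', e', e''⟩ := ih s₁ e₁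
      refine ⟨s', (Does.loop_step (by simp [h]) (Does.case_cons h d₁) d').mono ?_, ?_, e''.trans e₀⟩
      · simp only [List.length_cons]; nlinarith
      · rw [e', e₃]; simp [ins]
  have hins : ∀ (k : ℕ) (u : Fin k → Fin (N n)),
      w ++ ins (wiresCode u) = (List.ofFn fun a => w ++ wireCode (u a)).flatten ++ w := by
    intro k
    induction k with
    | zero => intro u; simp [ins, wiresCode]
    | succ k ih =>
      intro u
      have hw : wiresCode u = unary (u 0) ++ false :: wiresCode fun i : Fin k => u i.succ := by
        simp [wiresCode, wireCode, List.ofFn_succ]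
      have hu : ∀ j, ins (unary j) = unary j := by
        intro j
        induction j with
        | zero => rfl
        | succ j ihj => simpa [ins, unary, List.replicate_succ] using ihj
      have hi := ih fun i => u i.succ
      simp only [ins] at hi hu
      rw [hw]
      simp only [ins, List.flatMap_append, hu, List.flatMap_cons, List.ofFn_succ, List.flatten_cons,
        List.append_assoc, ← hi]
      simp [wireCode]
  have h0 : s 0 = [] := by simpa using h₃ 0
  have h3 : s 3 = [] := by simpa using h₃ 1
  obtain ⟨s', d, e, e0⟩ := key (wiresCode (v n)) (Function.update s 3 (w.reverse ++ s 3)) (by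
    simpa using h₁)
  have e' : s' 3 = w.reverse ++ ((List.ofFn fun a => w ++ wireCode (v n a)).flatten).reverse := by
    rw [e, Function.update_self, h3, List.append_nil, ← List.reverse_append, hins,
      List.reverse_append]
  have hlen : ((List.ofFn fun a => w ++ wireCode (v n a)).flatten).length ≤
      w.length + (wiresCode (v n)).length * (w.length + 1) := by
    have h1 : ∀ c, (ins c).length ≤ c.length * (w.length + 1) := by
      intro c
      induction c with
      | nil => simp [ins]
      | cons b c ih =>
        simp only [ins] at ih ⊢
        cases b <;> simp only [List.flatMap_cons, List.length_append, List.length_cons] <;>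
          simp <;> simp at ih <;> nlinarith
    have h2 := congrArg List.length (hins _ (v n))
    simp only [List.length_append] at h2
    have := h1 (wiresCode (v n))
    omega
  refine ⟨_, ((does_pushList 3 w.reverse s).seq (d.seq ((does_popMany 3 w.length s').seq
    (does_move (l := ((List.ofFn fun a => w ++ wireCode (v n a)).flatten).reverse)
      (by decide) ?_)))).mono ?_, ?_⟩
  · simp [e']
  · simp only [List.length_reverse, Polynomial.eval_add, Polynomial.eval_mul,
      Polynomial.eval_natCast, Polynomial.eval_X, Nat.cast_id]
    nlinarith [Nat.zero_le ((wiresCode (v n)).length * w.length)]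
  · simp [e0, h0]

/-! ### Linearity and trace preservation -/

theorem conj_add {N : ℕ} (U : Matrix (Bits N) (Bits N) ℂ) (ρ σ : QState N) :
    conj U (ρ + σ) = conj U ρ + conj U σ := by
  simp [conj, mul_add, add_mul]

theorem conj_smul {N : ℕ} (U : Matrix (Bits N) (Bits N) ℂ) (c : ℂ) (ρ : QState N) :
    conj U (c • ρ) = c • conj U ρ := by
  simp [conj]

theorem trace_conj {N : ℕ} {U : Matrix (Bits N) (Bits N) ℂ} (hU : Uᴴ * U = 1) (ρ : QState N) :
    (conj U ρ).trace = ρ.trace := by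
  rw [conj, Matrix.trace_mul_cycle, hU, one_mul]

theorem basisMap_isometry {N : ℕ} {f : Bits N → Bits N} (hf : Function.Injective f) :
    (basisMap f)ᴴ * basisMap f = 1 := by
  ext x y
  simp [basisMap, Matrix.mul_apply, Matrix.one_apply, hf.eq_iff, apply_ite, eq_comm]

/-- Row `x` of the operator is supported on the two strings that agree with `x` away from `i`. -/
theorem sum_onQubit_mul {N : ℕ} (i : Fin N) (u : Matrix Bool Bool ℂ) (x : Bits N)
    (g : Bits N → ℂ) :
    ∑ z, onQubit i u x z * g z = ∑ b, u (x i) b * g (Function.update x i b) := by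
  have h : ∀ b, u (x i) b * g (Function.update x i b) =
      ∑ z, if z = Function.update x i b then u (x i) (z i) * g z else 0 := by
    intro b; simp
  simp_rw [h]
  rw [Finset.sum_comm]
  refine Finset.sum_congr rfl fun z _ => ?_
  have h' : ∀ b, z = Function.update x i b ↔ (∀ j, j ≠ i → x j = z j) ∧ z i = b := by
    intro b
    rw [eq_comm, Function.update_eq_iff]
    constructor
    · rintro ⟨rfl, h⟩; exact ⟨h, rfl⟩
    · rintro ⟨h, rfl⟩; exact ⟨rfl, h⟩
  simp_rw [h']
  by_cases hz : ∀ j, j ≠ i → x j = z j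
  · simp only [onQubit, Matrix.of_apply, eq_true hz, true_and, Finset.sum_ite_eq,
      Finset.mem_univ, if_true]
  · simp only [onQubit, Matrix.of_apply, eq_false hz, false_and, if_false, zero_mul,
      Finset.sum_const_zero]

theorem onQubit_isometry {N : ℕ} (i : Fin N) {u : Matrix Bool Bool ℂ} (hu : uᴴ * u = 1) :
    (onQubit i u)ᴴ * onQubit i u = 1 := by
  have h : (onQubit i u)ᴴ = onQubit i uᴴ := by
    ext x y
    have : (∀ j, j ≠ i → y j = x j) ↔ ∀ j, j ≠ i → x j = y j := by simp only [eq_comm]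
    simp only [onQubit, Matrix.conjTranspose_apply, Matrix.of_apply, this]
    split_ifs <;> simp
  ext x y
  rw [h, Matrix.mul_apply, sum_onQubit_mul]
  have h' : ∀ b, (∀ j, j ≠ i → Function.update x i b j = y j) ↔ ∀ j, j ≠ i → x j = y j :=
    fun b => forall₂_congr fun j hj => by rw [Function.update_of_ne hj]
  have hu' : ∑ b, uᴴ (x i) b * u b (y i) = if x i = y i then 1 else 0 := by
    rw [← Matrix.mul_apply, hu, Matrix.one_apply]
  simp only [onQubit, Matrix.of_apply, h', Function.update_self]
  by_cases hz : ∀ j, j ≠ i → x j = y j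
  · simp only [if_pos hz, hu', Matrix.one_apply]
    refine if_congr ⟨fun h => funext fun j => ?_, fun h => by rw [h]⟩ rfl rfl
    by_cases hj : j = i
    · rw [hj, h]
    · exact hz j hj
  · have : x ≠ y := by rintro rfl; exact hz fun _ _ => rfl
    simp [hz, this]

theorem hadamard_isometry : hadamardᴴ * hadamard = 1 := by
  have h : ((Real.sqrt 2 : ℝ) : ℂ) * (Real.sqrt 2 : ℝ) = 2 := by
    rw [← Complex.ofReal_mul]; norm_num
  have h0 : ((Real.sqrt 2 : ℝ) : ℂ) ≠ 0 := by simp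
  ext a b
  cases a <;> cases b <;> simp [hadamard, Matrix.mul_apply] <;> field_simp <;>
    norm_num [pow_two, h]

theorem tGate_isometry : tGateᴴ * tGate = 1 := by
  have h : (starRingEnd ℂ) (Complex.exp (Complex.I * Real.pi / 4)) *
      Complex.exp (Complex.I * Real.pi / 4) = 1 := by
    rw [← Complex.exp_conj, ← Complex.exp_add]
    simp [neg_div, Complex.conj_ofNat]
  ext a b
  cases a <;> cases b <;> simp [tGate, Matrix.mul_apply, Matrix.diagonal_apply, h]

theorem xorAt_involutive {N b : ℕ} (w : Fin b ↪ Fin N) (v : Bits b) :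
    Function.Involutive (xorAt w v) := by
  intro x
  funext i
  simp [xorAt]

/-- The input and output registers are disjoint, so the first query leaves the argument of `f`
intact and the second adds the same value again. -/
theorem oracle_involutive {N a b : ℕ} (q : Fin a ⊕ Fin b ↪ Fin N) (f : Bits a → Bits b) :
    Function.Involutive fun x : Bits N =>
      xorAt (Function.Embedding.inr.trans q) (f fun i => x (q (.inl i))) x := by
  intro x
  have h : ∀ v, (fun i => xorAt (Function.Embedding.inr.trans q) v x (q (.inl i))) =
      fun i => x (q (.inl i)) := by
    intro v
    funext i
    simp [xorAt]
  simp only [h]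
  exact xorAt_involutive _ _ x

theorem oracleU_isometry {N a b : ℕ} (q : Fin a ⊕ Fin b ↪ Fin N) (f : Bits a → Bits b) :
    (oracleU q f)ᴴ * oracleU q f = 1 :=
  basisMap_isometry (oracle_involutive q f).injective

theorem trace_apply (S : EncScheme) {n N : ℕ} (k : Bits (S.keyLen n))
    (g : Gate N (S.msgLen n) (S.ctLen n)) (ρ : QState N) : (g.apply S k ρ).trace = ρ.trace := by
  cases g <;> simp only [Gate.apply]
  case x i =>
    refine trace_conj (basisMap_isometry (Function.Involutive.injective fun z => ?_)) ρ
    simp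
  case h i => exact trace_conj (onQubit_isometry i hadamard_isometry) ρ
  case t i => exact trace_conj (onQubit_isometry i tGate_isometry) ρ
  case cnot i j hij =>
    refine trace_conj (basisMap_isometry (Function.Involutive.injective fun z => ?_)) ρ
    simp [hij]
  case measure i => simp [Matrix.trace]
  case enc q =>
    have h : ∀ r, (conj (oracleU q fun m => S.enc n k m r) ρ).trace = ρ.trace := fun r =>
      trace_conj (oracleU_isometry q _) ρ
    simp only [Finset.expect, Matrix.trace_smul, Matrix.trace_sum, h]
    exact Fintype.expect_const (ι := Bits (S.encCoinLen n)) ρ.trace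
  case dec q => exact trace_conj (oracleU_isometry q _) ρ

theorem apply_add (S : EncScheme) {n N : ℕ} (k : Bits (S.keyLen n))
    (g : Gate N (S.msgLen n) (S.ctLen n)) (ρ σ : QState N) :
    g.apply S k (ρ + σ) = g.apply S k ρ + g.apply S k σ := by
  cases g <;> simp only [Gate.apply, conj_add, Finset.expect_add_distrib]
  ext x y
  simp only [Matrix.of_apply, Matrix.add_apply]
  split_ifs <;> simp

theorem apply_smul (S : EncScheme) {n N : ℕ} (k : Bits (S.keyLen n))
    (g : Gate N (S.msgLen n) (S.ctLen n)) (c : ℂ) (ρ : QState N) :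
    g.apply S k (c • ρ) = c • g.apply S k ρ := by
  cases g <;> simp only [Gate.apply, conj_smul, Finset.smul_expect]
  ext x y
  simp

theorem runCircuit_append (S : EncScheme) {n N : ℕ} (k : Bits (S.keyLen n))
    (C D : List (Gate N (S.msgLen n) (S.ctLen n))) (ρ : QState N) :
    runCircuit S k (C ++ D) ρ = runCircuit S k D (runCircuit S k C ρ) :=
  List.foldl_append ..

theorem trace_runCircuit (S : EncScheme) {n N : ℕ} (k : Bits (S.keyLen n))
    (C : List (Gate N (S.msgLen n) (S.ctLen n))) (ρ : QState N) :
    (runCircuit S k C ρ).trace = ρ.trace := by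
  induction C generalizing ρ with
  | nil => rfl
  | cons g C ih => exact (ih _).trans (trace_apply S k g ρ)

theorem runCircuit_add (S : EncScheme) {n N : ℕ} (k : Bits (S.keyLen n))
    (C : List (Gate N (S.msgLen n) (S.ctLen n))) (ρ σ : QState N) :
    runCircuit S k C (ρ + σ) = runCircuit S k C ρ + runCircuit S k C σ := by
  induction C generalizing ρ σ with
  | nil => rfl
  | cons g C ih => simpa [runCircuit, apply_add] using ih _ _

theorem runCircuit_smul (S : EncScheme) {n N : ℕ} (k : Bits (S.keyLen n))
    (C : List (Gate N (S.msgLen n) (S.ctLen n))) (c : ℂ) (ρ : QState N) :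
    runCircuit S k C (c • ρ) = c • runCircuit S k C ρ := by
  induction C generalizing ρ with
  | nil => rfl
  | cons g C ih => simpa [runCircuit, apply_smul] using ih _

/-! ### Outcome probabilities -/

/-- The probability that measuring the qubit `i` gives `b`. -/
noncomputable def accept {N : ℕ} (i : Fin N) (b : Bool) (ρ : QState N) : ℝ :=
  ∑ z : Bits N, if z i = b then (ρ z z).re else 0

theorem accept_true_add_false {N : ℕ} (i : Fin N) (ρ : QState N) :
    accept i true ρ + accept i false ρ = ρ.trace.re := by
  simp only [accept, ← Finset.sum_add_distrib, Matrix.trace, Complex.re_sum, Matrix.diag_apply]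
  refine Finset.sum_congr rfl fun z _ => ?_
  cases z i <;> simp

/-- What the adversary does from the challenge on, applied to the state `ρ`: the probability of the
output bit `b`. It is additive in `ρ`. -/
noncomputable def Adversary.challenge {S : EncScheme} {j : ℕ} (A : Adversary S j) (n : ℕ)
    (k : Bits (S.keyLen n)) (c : Bits (S.ctLen n)) (b : Bool) : QState (A.width n) →+ ℝ where
  toFun ρ := accept (A.answer n) b
    (runCircuit S k (A.post n) (conj (basisMap (xorAt (A.chal n) c)) ρ))
  -- Homogeneity for the scalar 0.
  map_zero' := by
    have h := runCircuit_smul S k (A.post n) 0 0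
    have h' := conj_smul (basisMap (xorAt (A.chal n) c)) 0 0
    simp only [zero_smul] at h h'
    simp [h, h', accept]
  map_add' ρ σ := by
    simp only [conj_add, runCircuit_add, accept, Matrix.add_apply, Complex.add_re,
      ← Finset.sum_add_distrib]
    refine Finset.sum_congr rfl fun z _ => ?_
    split_ifs <;> simp

/-- Exhibits the probability as an additive function of the projected state, so that sums over
outcomes can be moved inside. -/
theorem Adversary.prob_eq {S : EncScheme} {j : ℕ} (A : Adversary S j) (n : ℕ)
    (k : Bits (S.keyLen n)) (m : Fin j → Bits (S.msgLen n)) (c : Bits (S.ctLen n)) (b : Bool) :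
    A.prob n k m c b = A.challenge n k c b (project (A.out n) (fun a => m a.1 a.2)
      (runCircuit S k (A.pre n) (zeroState (A.width n)))) := rfl

/-- Each diagonal entry survives in exactly one projection, the one for the messages that the basis
state shows. -/
theorem sum_project {N j l : ℕ} (w : Fin j × Fin l ↪ Fin N) (ρ : QState N) :
    (∑ m : Fin j → Bits l, project w (fun a => m a.1 a.2) ρ).trace = ρ.trace := by
  rw [Matrix.trace, Matrix.trace]
  refine Finset.sum_congr rfl fun x _ => ?_
  rw [Matrix.diag_apply, Matrix.sum_apply, Finset.sum_eq_single fun i a => x (w (i, a))]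
  · simp [project]
  · intro m _ hm
    simp only [project, Matrix.of_apply, and_self]
    rw [if_neg]
    intro h
    exact hm (funext fun i => funext fun a => (h (i, a)).symm)
  · simp

/-- For every challenge ciphertext the probabilities of all outcomes add up to `1`. -/
theorem Adversary.sum_prob {S : EncScheme} {j : ℕ} (A : Adversary S j) (n : ℕ)
    (k : Bits (S.keyLen n)) (c : Bits (S.ctLen n)) :
    ∑ m, (A.prob n k m c true + A.prob n k m c false) = 1 := by
  have h : ∀ ρ : QState (A.width n),
      A.challenge n k c true ρ + A.challenge n k c false ρ = ρ.trace.re := by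
    intro ρ
    refine (accept_true_add_false _ _).trans ?_
    rw [trace_runCircuit, trace_conj (basisMap_isometry (xorAt_involutive _ _).injective)]
  simp only [Adversary.prob_eq]
  rw [Finset.sum_add_distrib, ← map_sum, ← map_sum, h, sum_project, trace_runCircuit, zeroState,
    Matrix.trace_single_eq_same, Complex.one_re]

theorem runCircuit_measure (S : EncScheme) {n N : ℕ} (k : Bits (S.keyLen n)) (L : List (Fin N))
    (ρ : QState N) :
    runCircuit S k (L.map Gate.measure) ρ =
      Matrix.of fun x y => if ∀ i ∈ L, x i = y i then ρ x y else 0 := by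
  induction L generalizing ρ with
  | nil => ext; simp [runCircuit]
  | cons i L ih =>
    refine (ih _).trans ?_
    ext x y
    simp only [Gate.apply, Matrix.of_apply, List.forall_mem_cons]
    split_ifs <;> simp_all

/-! ### From one challenge message to two -/

theorem circuitCode_append {N ℓ γ : ℕ} (C D : List (Gate N ℓ γ)) :
    circuitCode (C ++ D) = circuitCode C ++ circuitCode D := by
  simp [circuitCode]

/-- The number of the challenge message that is encrypted if the challenge bit is `d`. -/
def msgIndex (d : Bool) : Fin 2 := if d then 1 else 0

/-- The adversary that submits only the challenge message number `d` of `A`, measures the other one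
itself, and adds `d` to the output bit of `A`. -/
def Adversary.pick {S : EncScheme} (A : Adversary S 2) (d : Bool) : Adversary S 1 where
  width := A.width
  pre n := A.pre n ++ (List.ofFn fun a => A.out n (msgIndex (!d), a)).map Gate.measure
  out n := ⟨fun a => A.out n (msgIndex d, a.2), fun a b h => by
    have := (A.out n).injective h
    exact Prod.ext (Subsingleton.elim _ _) (Prod.mk.inj this).2⟩
  chal := A.chal
  post n := A.post n ++ if d then [Gate.x (A.answer n)] else []
  answer := A.answer
  post_noDec n g hg := by
    rcases List.mem_append.1 hg with h | h
    · exact A.post_noDec n g h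
    · cases d <;> simp at h
      subst h
      trivial
  width_uniform := A.width_uniform
  pre_uniform := by
    simp only [circuitCode_append]
    refine A.pre_uniform.append ?_
    -- The three bits are the kind of a measurement gate.
    convert (A.out_uniform (msgIndex (!d))).prefixWires [true, false, false] using 2
    simp [circuitCode, List.map_ofFn, Function.comp_def, Gate.code]
  out_uniform _ := A.out_uniform (msgIndex d)
  chal_uniform := A.chal_uniform
  post_uniform := by
    cases d
    · simpa using A.post_uniform
    · simp only [circuitCode_append]
      refine A.post_uniform.append ?_
      simpa [circuitCode, Gate.code] using
        (uniform_const [false, false, false]).append A.answer_uniform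
  answer_uniform := A.answer_uniform

theorem conj_basisMap {N : ℕ} {f : Bits N → Bits N} (hf : Function.Involutive f) (ρ : QState N) :
    conj (basisMap f) ρ = ρ.submatrix f f := by
  have h : ∀ x z, x = f z ↔ z = f x := fun x z =>
    ⟨fun h => by rw [h, hf z], fun h => by rw [h, hf x]⟩
  ext x y
  simp only [conj, Matrix.mul_apply, basisMap, Matrix.conjTranspose_apply, Matrix.of_apply, h x, h y]
  simp [apply_ite]

theorem accept_conj_not {N : ℕ} (i : Fin N) (b : Bool) (ρ : QState N) :
    accept i b (conj (basisMap fun z => Function.update z i (!(z i))) ρ) = accept i (!b) ρ := by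
  have hf : Function.Involutive fun z : Bits N => Function.update z i (!(z i)) := fun z => by simp
  rw [conj_basisMap hf]
  refine Fintype.sum_equiv hf.toPerm _ _ fun z => ?_
  cases b <;> simp

theorem Adversary.pick_challenge {S : EncScheme} (A : Adversary S 2) (d : Bool) (n : ℕ)
    (k : Bits (S.keyLen n)) (c : Bits (S.ctLen n)) (b : Bool) (ρ : QState (A.width n)) :
    (A.pick d).challenge n k c b ρ = A.challenge n k c (xor b d) ρ := by
  have h : (A.pick d).challenge n k c b ρ = accept (A.answer n) b (runCircuit S k
      (A.post n ++ if d then [Gate.x (A.answer n)] else [])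
      (conj (basisMap (xorAt (A.chal n) c)) ρ)) := rfl
  rw [h, runCircuit_append]
  cases d
  · rw [Bool.xor_false]; rfl
  · rw [Bool.xor_true]
    exact accept_conj_not _ _ _

/-- Measuring the other message and discarding the outcome. -/
theorem project_measure {N l : ℕ} (w : Fin 2 × Fin l ↪ Fin N) (w' : Fin 1 × Fin l ↪ Fin N)
    (d : Bool) (hw : ∀ a, w' a = w (msgIndex d, a.2)) (m : Fin 1 → Bits l) (ρ : QState N) :
    project w' (fun a => m a.1 a.2) (Matrix.of fun x y =>
        if ∀ i ∈ List.ofFn fun a => w (msgIndex (!d), a), x i = y i then ρ x y else 0) =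
      ∑ m₂ : Fin 2 → Bits l,
        if m₂ (msgIndex d) = m 0 then project w (fun a => m₂ a.1 a.2) ρ else 0 := by
  have hd : ∀ p : Fin 2 → Prop, (∀ i, p i) ↔ p (msgIndex d) ∧ p (msgIndex (!d)) := by
    intro p
    rw [Fin.forall_fin_two]
    cases d
    · rfl
    · exact and_comm
  ext x y
  -- Only the outcome that `x` shows contributes to the entry `(x, y)`. For it, the condition on `y`
  -- splits into the submitted message, fixed to `m 0`, and agreement with `x` on the measured one.
  rw [Matrix.sum_apply, Finset.sum_eq_single fun i a => x (w (i, a))]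
  · have h1 : ((∀ a, x (w' a) = m a.1 a.2) ∧ ∀ a, y (w' a) = m a.1 a.2) ↔
        (fun a => x (w (msgIndex d, a))) = m 0 ∧ (fun a => y (w (msgIndex d, a))) = m 0 := by
      simp [hw, funext_iff]
    by_cases h : (fun a => x (w (msgIndex d, a))) = m 0
    · simp only [project, Matrix.of_apply, h1, h, if_true, true_and, List.forall_mem_ofFn_iff,
        implies_true]
      rw [← ite_and]
      refine if_congr ?_ rfl rfl
      rw [Prod.forall, hd, ← h, funext_iff]
      refine and_congr_right' (forall_congr' fun a => eq_comm)
    · simp only [project, Matrix.of_apply, h1, h, false_and, if_false,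
        Matrix.zero_apply]
  · intro m₂ _ hm
    split_ifs
    · simp only [project, Matrix.of_apply]
      rw [if_neg]
      rintro ⟨h, -⟩
      exact hm (funext fun i => funext fun a => (h (i, a)).symm)
    · rfl
  · simp

/-- The message kept back is measured but not reported, so its outcomes are summed over; the final X
gate accounts for `xor b d`. -/
theorem Adversary.pick_prob {S : EncScheme} (A : Adversary S 2) (d : Bool) (n : ℕ)
    (k : Bits (S.keyLen n)) (m : Fin 1 → Bits (S.msgLen n)) (c : Bits (S.ctLen n)) (b : Bool) :
    (A.pick d).prob n k m c b =
      ∑ m₂, if m₂ (msgIndex d) = m 0 then A.prob n k m₂ c (xor b d) else 0 := by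
  have h : runCircuit S k ((A.pick d).pre n) (zeroState ((A.pick d).width n)) =
      Matrix.of fun x y => if ∀ i ∈ List.ofFn fun a => A.out n (msgIndex (!d), a), x i = y i then
        runCircuit S k (A.pre n) (zeroState (A.width n)) x y else 0 :=
    (runCircuit_append ..).trans (runCircuit_measure ..)
  rw [Adversary.prob_eq, h]
  refine (A.pick_challenge d n k c b _).trans ?_
  refine (congrArg (A.challenge n k c (xor b d)) (project_measure (A.out n) ((A.pick d).out n) d
    (fun _ => rfl) m _)).trans ?_
  rw [map_sum]
  refine Finset.sum_congr rfl fun m₂ _ => ?_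
  split_ifs
  · rfl
  · exact map_zero _

theorem expect_bool (f : Bool → ℝ) : 𝔼 b, f b = (f true + f false) / 2 := by
  rw [Fintype.expect_eq_sum_div_card]
  simp

theorem Adversary.pick_winProb {S : EncScheme} (A : Adversary S 2) (d : Bool) (n : ℕ) :
    indGame'WinProb S (A.pick d) n =
      𝔼 s : Bits (S.keyCoinLen n), 𝔼 b : Bool, ∑ m : Fin 2 → Bits (S.msgLen n),
        𝔼 x : Bits (S.msgLen n), 𝔼 r : Bits (S.encCoinLen n),
          A.prob n (S.keyGen n s) m
            (S.enc n (S.keyGen n s) (if b then x else m (msgIndex d)) r) (xor b d) := by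
  refine Finset.expect_congr rfl fun s _ => Finset.expect_congr rfl fun b _ => ?_
  simp only [Adversary.pick_prob, Finset.expect_sum_comm]
  rw [Finset.sum_comm]
  refine Finset.sum_congr rfl fun m₂ _ => ?_
  -- The submitted message is determined by the pair `m₂`.
  rw [Finset.sum_eq_single fun _ => m₂ (msgIndex d)]
  · simp
  · intro m _ hm
    have : m₂ (msgIndex d) ≠ m 0 := fun h => hm (funext fun i => by rw [Subsingleton.elim i 0, h])
    simp [this]
  · simp

/-- For `b = false` the two reductions reproduce the two cases of `IndGame`. For `b = true` both see
a random message, and they win on opposite answers of `A`, so these terms add up to a constant. -/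
theorem Adversary.pick_winProb_add {S : EncScheme} (A : Adversary S 2) (n : ℕ) :
    indGame'WinProb S (A.pick false) n + indGame'WinProb S (A.pick true) n =
      indGameWinProb S A n + 1 / 2 := by
  have h : ∀ s : Bits (S.keyCoinLen n),
      (∑ m, 𝔼 x : Bits (S.msgLen n), 𝔼 r : Bits (S.encCoinLen n),
        A.prob n (S.keyGen n s) m (S.enc n (S.keyGen n s) x r) true) +
      (∑ m, 𝔼 x : Bits (S.msgLen n), 𝔼 r : Bits (S.encCoinLen n),
        A.prob n (S.keyGen n s) m (S.enc n (S.keyGen n s) x r) false) = 1 := by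
    intro s
    simp only [← Finset.expect_sum_comm, ← Finset.expect_add_distrib, ← Finset.sum_add_distrib,
      A.sum_prob, Fintype.expect_const]
  rw [A.pick_winProb, A.pick_winProb, indGameWinProb, ← Finset.expect_add_distrib]
  have h2 : (1 / 2 : ℝ) = 𝔼 _s : Bits (S.keyCoinLen n), (1 / 2 : ℝ) :=
    (Fintype.expect_const _).symm
  rw [h2, ← Finset.expect_add_distrib]
  refine Finset.expect_congr rfl fun s _ => ?_
  have := h s
  simp only [expect_bool, if_true, Bool.false_eq_true, if_false, Bool.xor_false, Bool.xor_true,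
    Bool.not_true, Bool.not_false, msgIndex, Fintype.expect_const]
  linarith

/-! ### From two challenge messages to one -/

/-- The tensor product of operators on the first `N` and the last `l` of `N + l` qubits. -/
def tens {N l : ℕ} (A : Matrix (Bits N) (Bits N) ℂ) (B : Matrix (Bits l) (Bits l) ℂ) :
    Matrix (Bits (N + l)) (Bits (N + l)) ℂ :=
  Matrix.of fun x y => A (fun i => x (Fin.castAdd l i)) (fun i => y (Fin.castAdd l i)) *
    B (fun i => x (Fin.natAdd N i)) (fun i => y (Fin.natAdd N i))

theorem tens_mul {N l : ℕ} (A C : Matrix (Bits N) (Bits N) ℂ) (B D : Matrix (Bits l) (Bits l) ℂ) :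
    tens A B * tens C D = tens (A * C) (B * D) := by
  have h : ∀ (A : Matrix (Bits N) (Bits N) ℂ) (B : Matrix (Bits l) (Bits l) ℂ), tens A B =
      (Matrix.kroneckerMap (· * ·) A B).submatrix (Fin.appendEquiv N l).symm
        (Fin.appendEquiv N l).symm := fun _ _ => rfl
  rw [h, h, h, Matrix.submatrix_mul_equiv, Matrix.mul_kronecker_mul]

theorem conj_tens {N l : ℕ} (A ρ : Matrix (Bits N) (Bits N) ℂ)
    (B σ : Matrix (Bits l) (Bits l) ℂ) :
    conj (tens A B) (tens ρ σ) = tens (conj A ρ) (conj B σ) := by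
  have h : (tens A B)ᴴ = tens Aᴴ Bᴴ := by ext x y; simp [tens]
  rw [conj, h, tens_mul, tens_mul]; rfl

theorem conj_one {N : ℕ} (ρ : QState N) : conj 1 ρ = ρ := by simp [conj]

theorem bits_ext {N l : ℕ} {x y : Bits (N + l)} :
    x = y ↔ (fun i => x (Fin.castAdd l i)) = (fun i => y (Fin.castAdd l i)) ∧
      (fun i => x (Fin.natAdd N i)) = fun i => y (Fin.natAdd N i) :=
  (Fin.appendEquiv N l).symm.injective.eq_iff.symm.trans Prod.ext_iff

/-- A basis map that is `f` on the first qubits and fixes the others is the tensor product of the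
map `f` with the identity. -/
theorem conj_basisMap_tens {N l : ℕ} {F : Bits (N + l) → Bits (N + l)} {f : Bits N → Bits N}
    (hl : ∀ z, (fun i => F z (Fin.castAdd l i)) = f fun i => z (Fin.castAdd l i))
    (hr : ∀ z i, F z (Fin.natAdd N i) = z (Fin.natAdd N i)) (ρ : QState N) (σ : QState l) :
    conj (basisMap F) (tens ρ σ) = tens (conj (basisMap f) ρ) σ := by
  have h : basisMap F = tens (basisMap f) 1 := by
    ext x y
    simp only [basisMap, tens, Matrix.of_apply, Matrix.one_apply, mul_ite, mul_one, mul_zero,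
      ← ite_and]
    refine if_congr ?_ rfl rfl
    rw [bits_ext, hl, and_comm]
    simp only [hr]
  rw [h, conj_tens, conj_one]

theorem conj_onQubit_castAdd {N l : ℕ} (i : Fin N) (u : Matrix Bool Bool ℂ) (ρ : QState N)
    (σ : QState l) :
    conj (onQubit (Fin.castAdd l i) u) (tens ρ σ) = tens (conj (onQubit i u) ρ) σ := by
  have h : onQubit (Fin.castAdd l i) u = tens (onQubit i u) 1 := by
    ext x y
    simp only [onQubit, tens, Matrix.of_apply, Matrix.one_apply, mul_ite, mul_one, mul_zero,
      ← ite_and, Fin.forall_fin_add, funext_iff]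
    refine if_congr (and_comm.trans (and_congr ?_ ?_)) rfl rfl
    · refine forall_congr' fun j => ?_
      simp [Fin.ext_iff, show N + (j : ℕ) ≠ i by omega]
    · simp
  rw [h, conj_tens, conj_one]

theorem conj_onQubit_natAdd {N l : ℕ} (i : Fin l) (u : Matrix Bool Bool ℂ) (ρ : QState N)
    (σ : QState l) :
    conj (onQubit (Fin.natAdd N i) u) (tens ρ σ) = tens ρ (conj (onQubit i u) σ) := by
  have h : onQubit (Fin.natAdd N i) u = tens 1 (onQubit i u) := by
    ext x y
    simp only [onQubit, tens, Matrix.of_apply, Matrix.one_apply, ite_mul, one_mul, zero_mul,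
      ← ite_and, Fin.forall_fin_add, funext_iff]
    refine if_congr (and_congr ?_ ?_) rfl rfl
    · refine forall_congr' fun j => ?_
      simp [Fin.ext_iff, show (j : ℕ) ≠ N + i by omega]
    · simp
  rw [h, conj_tens, conj_one]

theorem zeroState_add (N l : ℕ) : zeroState (N + l) = tens (zeroState N) (zeroState l) := by
  ext x y
  simp only [zeroState, tens, Matrix.of_apply, Matrix.single_apply, mul_ite, mul_one, mul_zero,
    ← ite_and]
  refine if_congr ?_ rfl rfl
  rw [bits_ext, bits_ext (x := fun _ => false) (y := y)]
  tauto

/-- The same gate on the first `N` of `N + l` qubits. -/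
def Gate.lift {N ℓ γ : ℕ} (l : ℕ) : Gate N ℓ γ → Gate (N + l) ℓ γ
  | .x i => .x (Fin.castAdd l i)
  | .h i => .h (Fin.castAdd l i)
  | .t i => .t (Fin.castAdd l i)
  | .cnot i j hij => .cnot (Fin.castAdd l i) (Fin.castAdd l j) (by simpa using hij)
  | .measure i => .measure (Fin.castAdd l i)
  | .enc q => .enc (q.trans (Fin.castAddEmb l))
  | .dec q => .dec (q.trans (Fin.castAddEmb l))

/-- Codes mention only wire indices, never the width, so uniformity passes to the widened circuits
unchanged. -/
theorem Gate.code_lift {N ℓ γ : ℕ} (l : ℕ) (g : Gate N ℓ γ) : (g.lift l).code = g.code := by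
  cases g <;> rfl

theorem Gate.NoDec.lift {N ℓ γ : ℕ} (l : ℕ) {g : Gate N ℓ γ} (h : g.NoDec) : (g.lift l).NoDec := by
  cases g <;> trivial

theorem circuitCode_lift {N ℓ γ : ℕ} (l : ℕ) (C : List (Gate N ℓ γ)) :
    circuitCode (C.map (Gate.lift l)) = circuitCode C := by
  simp [circuitCode, Gate.code_lift, Function.comp_def]

theorem xorAt_castAdd {N b : ℕ} (l : ℕ) (w : Fin b ↪ Fin N) (v : Bits b) (z : Bits (N + l)) :
    (fun i => xorAt (w.trans (Fin.castAddEmb l)) v z (Fin.castAdd l i)) =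
      xorAt w v fun i => z (Fin.castAdd l i) := by
  funext i
  simp [xorAt]

theorem xorAt_natAdd {N b : ℕ} (l : ℕ) (w : Fin b ↪ Fin N) (v : Bits b) (z : Bits (N + l))
    (i : Fin l) :
    xorAt (w.trans (Fin.castAddEmb l)) v z (Fin.natAdd N i) = z (Fin.natAdd N i) := by
  have h : ∀ j, ¬ (Fin.castAdd l (w j) = Fin.natAdd N i) := fun j hj => by
    have := congrArg Fin.val hj
    simp only [Fin.val_castAdd, Fin.val_natAdd] at this
    omega
  simp [xorAt, h]

theorem conj_oracleU_lift {N a b l : ℕ} (q : Fin a ⊕ Fin b ↪ Fin N) (f : Bits a → Bits b)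
    (ρ : QState N) (σ : QState l) :
    conj (oracleU (q.trans (Fin.castAddEmb l)) f) (tens ρ σ) = tens (conj (oracleU q f) ρ) σ := by
  unfold oracleU
  refine conj_basisMap_tens (fun z => ?_) (fun z i => ?_) ρ σ
  · exact xorAt_castAdd l (Function.Embedding.inr.trans q)
      (f fun i => z (Fin.castAdd l (q (.inl i)))) z
  · exact xorAt_natAdd l (Function.Embedding.inr.trans q)
      (f fun i => z (Fin.castAdd l (q (.inl i)))) z i

theorem apply_lift (S : EncScheme) {n N l : ℕ} (k : Bits (S.keyLen n))
    (g : Gate N (S.msgLen n) (S.ctLen n)) (ρ : QState N) (σ : QState l) :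
    (g.lift l).apply S k (tens ρ σ) = tens (g.apply S k ρ) σ := by
  have hne : ∀ (i : Fin N) (j : Fin l), Fin.natAdd N j ≠ Fin.castAdd l i := fun i j h => by
    have := congrArg Fin.val h
    simp only [Fin.val_castAdd, Fin.val_natAdd] at this
    omega
  cases g <;> simp only [Gate.apply, Gate.lift]
  case x i =>
    refine conj_basisMap_tens (fun z => ?_) (fun z j => ?_) ρ σ
    · funext j
      simp [Function.update_apply]
    · simp [hne]
  case h i => exact conj_onQubit_castAdd i _ ρ σ
  case t i => exact conj_onQubit_castAdd i _ ρ σ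
  case cnot i j hij =>
    refine conj_basisMap_tens (fun z => ?_) (fun z j => ?_) ρ σ
    · funext j
      simp [Function.update_apply]
    · simp [hne]
  case measure i =>
    ext x y
    simp [tens, ite_mul]
  case enc q =>
    simp only [conj_oracleU_lift]
    ext x y
    simp [tens, Finset.expect, Matrix.sum_apply, Finset.sum_mul]
  case dec q => exact conj_oracleU_lift q _ ρ σ

theorem runCircuit_lift (S : EncScheme) {n N l : ℕ} (k : Bits (S.keyLen n))
    (C : List (Gate N (S.msgLen n) (S.ctLen n))) (ρ : QState N) (σ : QState l) :
    runCircuit S k (C.map (Gate.lift l)) (tens ρ σ) = tens (runCircuit S k C ρ) σ := by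
  induction C generalizing ρ with
  | nil => rfl
  | cons g C ih => simpa [runCircuit, apply_lift] using ih _

/-! ### A random message from Hadamard gates -/

/-- The product of `|+⟩` on the qubits in `T` and `|0⟩` on the others. -/
noncomputable def plusOn {l : ℕ} (T : Finset (Fin l)) : Bits l → ℂ :=
  fun x => ∏ a, if a ∈ T then 1 / (Real.sqrt 2 : ℂ) else if x a then 0 else 1

theorem hadamard_plusOn {l : ℕ} {T : Finset (Fin l)} {i : Fin l} (hi : i ∉ T) :
    onQubit i hadamard *ᵥ plusOn T = plusOn (insert i T) := by
  funext x
  -- Split off the factor of qubit `i`, which is the amplitude of `|0⟩` because `i ∉ T`.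
  have h : ∀ b, plusOn T (Function.update x i b) = (if b then 0 else 1) *
      ∏ a ∈ Finset.univ.erase i, if a ∈ T then 1 / (Real.sqrt 2 : ℂ) else if x a then 0 else 1 := by
    intro b
    rw [plusOn, ← Finset.mul_prod_erase _ _ (Finset.mem_univ i)]
    congr 1
    · simp [hi]
    · refine Finset.prod_congr rfl fun a ha => ?_
      rw [Function.update_of_ne (Finset.ne_of_mem_erase ha)]
  rw [Matrix.mulVec, dotProduct, sum_onQubit_mul, Fintype.sum_bool, h, h]
  rw [plusOn, ← Finset.mul_prod_erase _ _ (Finset.mem_univ i)]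
  have h' : ∏ a ∈ Finset.univ.erase i, (if a ∈ insert i T then 1 / (Real.sqrt 2 : ℂ) else
      if x a then 0 else 1) =
      ∏ a ∈ Finset.univ.erase i, if a ∈ T then 1 / (Real.sqrt 2 : ℂ) else if x a then 0 else 1 := by
    refine Finset.prod_congr rfl fun a ha => ?_
    simp [Finset.ne_of_mem_erase ha]
  rw [h']
  simp [hadamard]

theorem conj_vecMulVec {N : ℕ} (U : Matrix (Bits N) (Bits N) ℂ) (ψ : Bits N → ℂ) :
    conj U (Matrix.vecMulVec ψ (star ψ)) = Matrix.vecMulVec (U *ᵥ ψ) (star (U *ᵥ ψ)) := by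
  rw [conj, Matrix.mul_vecMulVec, Matrix.vecMulVec_mul, Matrix.star_mulVec]

/-- Each gate moves one wire into the `|+⟩` set, which is why `T` varies in the induction. No wire
may repeat, as a second Hadamard would undo the first. -/
theorem runCircuit_hadamard (S : EncScheme) {n N l : ℕ} (k : Bits (S.keyLen n)) (ρ : QState N)
    (L : List (Fin l)) (hL : L.Nodup) (T : Finset (Fin l)) (hT : ∀ a ∈ L, a ∉ T) :
    runCircuit S k (L.map fun a => Gate.h (Fin.natAdd N a))
        (tens ρ (Matrix.vecMulVec (plusOn T) (star (plusOn T)))) =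
      tens ρ (Matrix.vecMulVec (plusOn (L.toFinset ∪ T)) (star (plusOn (L.toFinset ∪ T)))) := by
  induction L generalizing T with
  | nil => simp [runCircuit]
  | cons a L ih =>
    rw [List.nodup_cons] at hL
    have hstep : (Gate.h (Fin.natAdd N a) : Gate (N + l) (S.msgLen n) (S.ctLen n)).apply S k
        (tens ρ (Matrix.vecMulVec (plusOn T) (star (plusOn T)))) =
        tens ρ (Matrix.vecMulVec (plusOn (insert a T)) (star (plusOn (insert a T)))) := by
      rw [← hadamard_plusOn (hT a (by simp)), ← conj_vecMulVec]
      exact conj_onQubit_natAdd a _ ρ _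
    have := ih hL.2 (insert a T) (fun b hb => by
      rw [Finset.mem_insert, not_or]
      exact ⟨fun h => hL.1 (h ▸ hb), hT b (List.mem_cons_of_mem a hb)⟩)
    rw [List.map_cons, runCircuit, List.foldl_cons, hstep]
    refine this.trans ?_
    rw [List.toFinset_cons, Finset.insert_union, Finset.union_insert]

theorem zeroState_eq_plusOn (l : ℕ) :
    zeroState l = Matrix.vecMulVec (plusOn ∅) (star (plusOn ∅)) := by
  have h : ∀ x : Bits l, plusOn ∅ x = if (fun _ => false) = x then 1 else 0 := by
    intro x
    simp only [plusOn, Finset.notMem_empty, if_false, funext_iff]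
    by_cases hx : ∀ a, false = x a
    · simp [← hx]
    · rw [if_neg hx]
      obtain ⟨a, ha⟩ := not_forall.1 hx
      exact Finset.prod_eq_zero (Finset.mem_univ a) (by simp at ha; simp [ha])
  ext x y
  simp [zeroState, Matrix.vecMulVec_apply, h, Matrix.single_apply, apply_ite, ← ite_and, and_comm]

theorem plusOn_univ {l : ℕ} (x y : Bits l) :
    Matrix.vecMulVec (plusOn Finset.univ) (star (plusOn Finset.univ)) x y =
      (((2 ^ l : ℝ)⁻¹ : ℝ) : ℂ) := by
  have h : ((Real.sqrt 2 : ℝ) : ℂ) * (Real.sqrt 2 : ℝ) = 2 := by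
    rw [← Complex.ofReal_mul]; norm_num
  simp [Matrix.vecMulVec_apply, plusOn, ← mul_pow, ← mul_inv, h]

theorem runCircuit_addRandom (S : EncScheme) {n N l : ℕ} (k : Bits (S.keyLen n))
    (C : List (Gate N (S.msgLen n) (S.ctLen n))) :
    runCircuit S k (C.map (Gate.lift l) ++ (List.finRange l).map fun a => Gate.h (Fin.natAdd N a))
        (zeroState (N + l)) =
      tens (runCircuit S k C (zeroState N))
        (Matrix.vecMulVec (plusOn Finset.univ) (star (plusOn Finset.univ))) := by
  rw [runCircuit_append, zeroState_add, runCircuit_lift, zeroState_eq_plusOn l,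
    runCircuit_hadamard S k _ _ (List.nodup_finRange _) ∅ (by simp)]
  have h : (List.finRange l).toFinset ∪ ∅ = Finset.univ := by ext; simp
  rw [h]

/-- All entries of the uniform superposition equal $2^{-l}$, so every outcome `m 1` has this weight,
leaves a basis state and does not disturb `ρ`. -/
theorem project_plusOn {N l : ℕ} (w : Fin 1 × Fin l ↪ Fin N) (w' : Fin 2 × Fin l ↪ Fin (N + l))
    (h₀ : ∀ a, w' (0, a) = Fin.castAdd l (w (0, a))) (h₁ : ∀ a, w' (1, a) = Fin.natAdd N a)
    (m : Fin 2 → Bits l) (ρ : QState N) :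
    project w' (fun a => m a.1 a.2)
        (tens ρ (Matrix.vecMulVec (plusOn Finset.univ) (star (plusOn Finset.univ)))) =
      tens (project w (fun a => m 0 a.2) ρ)
        (Matrix.single (m 1) (m 1) (((2 ^ l : ℝ)⁻¹ : ℝ) : ℂ)) := by
  have hout : ∀ x : Bits (N + l), (∀ a, x (w' a) = m a.1 a.2) ↔
      (∀ a, x (Fin.castAdd l (w a)) = m 0 a.2) ∧ m 1 = fun a => x (Fin.natAdd N a) := by
    intro x
    rw [Prod.forall, Fin.forall_fin_two, Prod.forall, Fin.forall_fin_one, funext_iff]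
    simp only [h₀, h₁]
    exact and_congr Iff.rfl (forall_congr' fun a => eq_comm)
  ext x y
  simp only [project, tens, Matrix.of_apply, plusOn_univ, Matrix.single_apply, hout, ite_mul,
    mul_ite, zero_mul, mul_zero, ← ite_and]
  exact if_congr (by tauto) rfl rfl

theorem accept_tens {N l : ℕ} (i : Fin N) (b : Bool) (ρ : QState N) (v : Bits l) (c : ℝ) :
    accept (Fin.castAdd l i) b (tens ρ (Matrix.single v v (c : ℂ))) = c * accept i b ρ := by
  rw [accept, ← (Fin.appendEquiv N l).sum_comp, Fintype.sum_prod_type, accept, Finset.mul_sum]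
  refine Finset.sum_congr rfl fun z _ => ?_
  rw [Finset.sum_eq_single v]
  · simp [Fin.appendEquiv, tens, mul_comm]
  · intro w _ hw
    simp [Fin.appendEquiv, tens, Matrix.single_apply, hw.symm]
  · simp

/-- Brings the fresh wires into the form produced by `Uniform.wires`. -/
theorem sum_natAdd_code (N l : ℕ) (w : List Bool) :
    ((List.finRange l).map fun a => w ++ wireCode (Fin.natAdd N a)).flatten =
      (List.range l).flatMap fun a => w ++ (unary (N + a) ++ [false]) := by
  rw [← List.map_coe_finRange_eq_range, List.flatMap_map]
  rfl

/-- The adversary that submits the challenge message of `A` and a uniformly random message, which it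
gets by measuring `|+⟩` on fresh qubits. -/
def Adversary.addRandom {S : EncScheme} (A : Adversary S 1) : Adversary S 2 where
  width n := A.width n + S.msgLen n
  pre n := (A.pre n).map (Gate.lift (S.msgLen n)) ++
    (List.finRange (S.msgLen n)).map fun a => Gate.h (Fin.natAdd (A.width n) a)
  out n := ⟨fun a => if a.1 = 0 then Fin.castAdd (S.msgLen n) (A.out n (0, a.2)) else
      Fin.natAdd (A.width n) a.2, by
    rintro ⟨i, a⟩ ⟨j, b⟩ h
    have := congrArg Fin.val h
    have hA : ((A.out n (0, a) : Fin _) : ℕ) < A.width n := (A.out n (0, a)).2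
    have hB : ((A.out n (0, b) : Fin _) : ℕ) < A.width n := (A.out n (0, b)).2
    fin_cases i <;> fin_cases j <;> simp [← Fin.ext_iff] at this ⊢ <;> first | exact this | omega⟩
  chal n := (A.chal n).trans (Fin.castAddEmb _)
  post n := (A.post n).map (Gate.lift (S.msgLen n))
  answer n := Fin.castAdd _ (A.answer n)
  post_noDec n g hg := by
    obtain ⟨g', hg', rfl⟩ := List.mem_map.1 hg
    exact (A.post_noDec n g' hg').lift _
  width_uniform := by
    simpa only [unary_add] using A.width_uniform.append S.msgLen_uniform
  pre_uniform := by
    have h := A.pre_uniform.append (A.width_uniform.wires S.msgLen_uniform [false, false, true])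
    refine Eq.mp (congrArg Uniform (funext fun n => ?_)) h
    rw [← sum_natAdd_code, circuitCode_append, circuitCode_lift]
    simp [circuitCode, Function.comp_def, Gate.code]
  out_uniform i := by
    fin_cases i
    · exact A.out_uniform 0
    · have h := A.width_uniform.wires S.msgLen_uniform []
      refine Eq.mp (congrArg Uniform (funext fun n => ?_)) h
      rw [← sum_natAdd_code, wiresCode, List.ofFn_eq_map]
      rfl
  chal_uniform := A.chal_uniform
  post_uniform := by simpa only [circuitCode_lift] using A.post_uniform
  answer_uniform := A.answer_uniform

theorem Adversary.addRandom_prob {S : EncScheme} (A : Adversary S 1) (n : ℕ)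
    (k : Bits (S.keyLen n)) (m : Fin 2 → Bits (S.msgLen n)) (c : Bits (S.ctLen n)) (b : Bool) :
    A.addRandom.prob n k m c b = (2 ^ S.msgLen n : ℝ)⁻¹ * A.prob n k (fun _ => m 0) c b := by
  rw [Adversary.prob_eq, Adversary.prob_eq]
  refine (congrArg (fun ρ => A.addRandom.challenge n k c b
    (project (A.addRandom.out n) (fun a => m a.1 a.2) ρ)) (runCircuit_addRandom S k _)).trans ?_
  refine (congrArg (A.addRandom.challenge n k c b) (project_plusOn (A.out n) (A.addRandom.out n)
    (fun _ => rfl) (fun _ => rfl) m _)).trans ?_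
  -- From the challenge on, everything acts on the wires of `A`; the collapsed fresh qubits only
  -- contribute their weight.
  refine Eq.trans ?_ (accept_tens _ _ _ (m 1) _)
  rw [← runCircuit_lift]
  rw [← conj_basisMap_tens (F := xorAt (A.addRandom.chal n) c)
    (fun z => xorAt_castAdd _ (A.chal n) c z) (fun z i => xorAt_natAdd _ (A.chal n) c z i)]
  rfl

/-- Summing over the second message with weight $2^{-\ell}$ is averaging over `x`, since $2^{\ell}$
is the number of messages. -/
theorem Adversary.addRandom_winProb {S : EncScheme} (A : Adversary S 1) (n : ℕ) :
    indGameWinProb S A.addRandom n = indGame'WinProb S A n := by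
  refine Finset.expect_congr rfl fun s _ => Finset.expect_congr rfl fun b _ => ?_
  simp only [Adversary.addRandom_prob, ← Finset.mul_expect]
  rw [← (finTwoArrowEquiv (Bits (S.msgLen n))).symm.sum_comp,
    ← (Equiv.funUnique (Fin 1) (Bits (S.msgLen n))).symm.sum_comp, Fintype.sum_prod_type]
  refine Finset.sum_congr rfl fun m _ => ?_
  rw [Fintype.expect_eq_sum_div_card, ← Finset.mul_sum, div_eq_inv_mul]
  congr 1
  simp

end QCCA1

theorem mainTheorem11 (S : QCCA1.EncScheme) :
    QCCA1.IsINDQCCA1 S ↔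
      ∀ A : QCCA1.Adversary S 1, ∃ ε : ℕ → ℝ, QCCA1.Negligible ε ∧
        ∀ n, QCCA1.indGame'WinProb S A n ≤ 1 / 2 + ε n := by
  constructor
  · intro h A
    simpa only [A.addRandom_winProb] using h A.addRandom
  · intro h A
    obtain ⟨ε₀, hε₀, h₀⟩ := h (A.pick false)
    obtain ⟨ε₁, hε₁, h₁⟩ := h (A.pick true)
    -- The two bounds sum to `1 + ε₀ n + ε₁ n`, and the identity for the sum takes off `1 / 2`.
    refine ⟨ε₀ + ε₁, Asymptotics.SuperpolynomialDecay.add hε₀ hε₁, fun n => ?_⟩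
    have := A.pick_winProb_add n
    have := h₀ n
    have := h₁ n
    rw [Pi.add_apply]
    linarith
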